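/- Let $\mathfrak M$ be a von Neumann algebra on a complex Hilbert space, with predual $\mathfrak M_*$ (the $\sigma$-weakly continuous linear functionals on $\mathfrak M$). A unital Schwartz map on $\mathfrak M$ is a $\sigma$-weakly continuous linear map $\Psi:\mathfrak M\to\mathfrak M$ with $\Psi(1)=1$ and $0\le\Psi(a^*)\Psi(a)\le\Psi(a^*a)$ for all $a\in\mathfrak M$; its multiplicative domain is $$\mathfrak D_\Psi=\{a\in\mathfrak M:\ \Psi(a^*a)=\Psi(a^*)\Psi(a)\ \text{ and }\ \Psi(aa^*)=\Psi(a)\Psi(a^*)\}.$$ Let $(\mathfrak M,\Phi,\varphi)$ be a quantum dynamical system: $\Phi$ is a unital Schwartz map on $\mathfrak M$, $\varphi$ is a faithful normal state on $\mathfrak M$ with $\varphi\circ\Phi=\varphi$, and $\Phi$ admits a $\varphi$-adjoint, i.e. there is a (necessarily unique) unital Schwartz map $\Phi^\sharp$ on $\mathfrak M$ with $\varphi(b\,\Phi(a))=\varphi(\Phi^\sharp(b)\,a)$ for all $a,b\in\mathfrak M$. Put $\Phi_k=\Phi^k$ for integers $k\ge 0$, $\Phi_k=(\Phi^\sharp)^{|k|}$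 for integers $k<0$, and $$\mathfrak D_\infty=\bigcap_{k\in\mathbb Z}\mathfrak D_{\Phi_k}.$$ Suppose that the system is completely irreversible, i.e. $\mathfrak D_\infty=\mathbb C1$. Then, for every $a\in\mathfrak M$, $\Phi^n(a)\to\varphi(a)1$ $\sigma$-weakly as $n\to\infty$. Hence $\varphi$ is of asymptotic equilibrium, that is, $$\lim_{n\to\infty}\omega(\Phi^n(a))=\omega(1)\,\varphi(a)\qquad\text{for all } a\in\mathfrak M,\ \omega\in\mathfrak M_*,$$ and the system is ergodic, that is, $$\lim_{N\to\infty}\frac1{N+1}\sum_{k=0}^{N}\bigl[\varphi(a\,\Phi^k(b))-\varphi(a)\varphi(b)\bigr]=0\qquad\text{for all } a,b\in\mathfrak M.$$ -/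

import Mathlib

open Filter Topology
open scoped ComplexOrder

noncomputable section

namespace QDS

variable {H : Type*} [NormedAddCommGroup H] [InnerProductSpace ℂ H] [CompleteSpace H]

/-- The elements of a von Neumann algebra `M` of operators on `H`, as a type. It carries its unital
`*`-algebra structure; its instance topology is the norm topology. -/
abbrev Elem (M : VonNeumannAlgebra H) : Type _ := M.toStarSubalgebra

/-- The functional `a ↦ ∑ₙ ⟨ξₙ, a ηₙ⟩`, for square-summable sequences `ξ`, `η` of vectors
(the series then converges absolutely). -/
def vectorFunctional (M : VonNeumannAlgebra H) (ξ η : lp (fun _ : ℕ => H) 2) (a : Elem M) : ℂ :=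
  ∑' n, inner ℂ (ξ n) ((a : H →L[ℂ] H) (η n))

/-- The `σ`-weak (ultraweak) topology on `M`: the coarsest topology that makes all the functionals
`a ↦ ∑ₙ ⟨ξₙ, a ηₙ⟩`, `ξ, η ∈ ℓ²(ℕ, H)`, continuous. -/
abbrev sigmaWeak (M : VonNeumannAlgebra H) : TopologicalSpace (Elem M) :=
  ⨅ (ξ : lp (fun _ : ℕ => H) 2) (η : lp (fun _ : ℕ => H) 2),
    TopologicalSpace.induced (vectorFunctional M ξ η) inferInstance

/-- The predual `M_*`: all `σ`-weakly continuous linear functionals on `M`. -/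
def predual (M : VonNeumannAlgebra H) : Set (Elem M →ₗ[ℂ] ℂ) :=
  {ω | Continuous[sigmaWeak M, inferInstance] ω}

/-- Unital Schwartz maps: `σ`-weakly continuous linear maps `Φ : M → M` with `Φ(1) = 1` and
`0 ≤ Φ(a*) Φ(a) ≤ Φ(a* a)` for all `a`. The order is that of operators on `H`. -/
structure IsUnitalSchwartzMap {M : VonNeumannAlgebra H} (Φ : Module.End ℂ (Elem M)) : Prop where
  normal : Continuous[sigmaWeak M, sigmaWeak M] Φ
  map_one : Φ 1 = 1
  nonneg : ∀ a : Elem M, 0 ≤ ((Φ (star a) * Φ a : Elem M) : H →L[ℂ] H)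
  schwarz : ∀ a : Elem M,
    ((Φ (star a) * Φ a : Elem M) : H →L[ℂ] H) ≤ ((Φ (star a * a) : Elem M) : H →L[ℂ] H)

/-- Faithful normal states: `σ`-weakly continuous linear functionals `φ` on `M` with `φ(1) = 1`,
`φ(a* a) ≥ 0` for all `a`, and `φ(a* a) = 0` only for `a = 0`. -/
structure IsFaithfulNormalState {M : VonNeumannAlgebra H} (φ : Elem M →ₗ[ℂ] ℂ) : Prop where
  normal : φ ∈ predual M
  map_one : φ 1 = 1
  nonneg : ∀ a : Elem M, 0 ≤ φ (star a * a)
  faithful : ∀ a : Elem M, φ (star a * a) = 0 → a = 0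

/-- `Ψ` is a `φ`-adjoint of `Φ`: a unital Schwartz map such that
`φ(b Φ(a)) = φ(Ψ(b) a)` for all `a`, `b`. -/
structure IsAdjoint {M : VonNeumannAlgebra H} (φ : Elem M →ₗ[ℂ] ℂ)
    (Φ Ψ : Module.End ℂ (Elem M)) : Prop where
  schwartz : IsUnitalSchwartzMap Ψ
  adjoint : ∀ a b : Elem M, φ (b * Φ a) = φ (Ψ b * a)

/-- The `φ`-adjoint is unique when `φ` is faithful. -/
theorem IsAdjoint.unique {M : VonNeumannAlgebra H} {φ : Elem M →ₗ[ℂ] ℂ}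
    (hφ : IsFaithfulNormalState φ) {Φ Ψ Ψ' : Module.End ℂ (Elem M)}
    (h : IsAdjoint φ Φ Ψ) (h' : IsAdjoint φ Φ Ψ') : Ψ = Ψ' := by
  ext1 b
  have key : ∀ a : Elem M, φ ((Ψ b - Ψ' b) * a) = 0 := fun a => by
    rw [sub_mul, map_sub, ← h.adjoint, ← h'.adjoint, sub_self]
  have h0 := hφ.faithful (star (Ψ b - Ψ' b)) (by rw [star_star]; exact key _)
  exact sub_eq_zero.mp (star_eq_zero.mp h0)

/-- The multiplicative domain `{a | Φ(a* a) = Φ(a*) Φ(a) and Φ(a a*) = Φ(a) Φ(a*)}`. -/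
def multiplicativeDomain {M : VonNeumannAlgebra H} (Φ : Module.End ℂ (Elem M)) : Set (Elem M) :=
  {a | Φ (star a * a) = Φ (star a) * Φ a ∧ Φ (a * star a) = Φ a * Φ (star a)}

end QDS

/-- A quantum dynamical system `(M, Φ, φ)` on the Hilbert space `H`: a von Neumann algebra `M`, a
unital Schwartz map `Φ` of `M` and a faithful normal state `φ` of `M` that is stationary for `Φ`,
such that `Φ` admits a `φ`-adjoint. -/
structure QuantumDynamicalSystem (H : Type*) [NormedAddCommGroup H] [InnerProductSpace ℂ H]
    [CompleteSpace H] where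
  /-- the von Neumann algebra -/
  M : VonNeumannAlgebra H
  /-- the dynamics -/
  Φ : Module.End ℂ (QDS.Elem M)
  /-- the stationary state -/
  φ : QDS.Elem M →ₗ[ℂ] ℂ
  schwartz : QDS.IsUnitalSchwartzMap Φ
  state : QDS.IsFaithfulNormalState φ
  stationary : ∀ a, φ (Φ a) = φ a
  exists_adjoint : ∃ Ψ : Module.End ℂ (QDS.Elem M), QDS.IsAdjoint φ Φ Ψ

namespace QuantumDynamicalSystem

variable {H : Type*} [NormedAddCommGroup H] [InnerProductSpace ℂ H] [CompleteSpace H]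

/-- The (unique) `φ`-adjoint `Φ♯` of the dynamics. -/
def sharp (S : QuantumDynamicalSystem H) : Module.End ℂ (QDS.Elem S.M) :=
  S.exists_adjoint.choose

theorem isAdjoint_sharp (S : QuantumDynamicalSystem H) : QDS.IsAdjoint S.φ S.Φ S.sharp :=
  S.exists_adjoint.choose_spec

/-- `Φ_k = Φ^k` for `k ≥ 0` and `Φ_k = (Φ♯)^|k|` for `k < 0`. -/
def power (S : QuantumDynamicalSystem H) (k : ℤ) : Module.End ℂ (QDS.Elem S.M) :=
  if 0 ≤ k then S.Φ ^ k.natAbs else S.sharp ^ k.natAbs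

/-- The reversible algebra `D_∞`: the intersection over all `k ∈ ℤ` of the multiplicative domains
of the maps `Φ_k`. -/
def reversibleAlgebra (S : QuantumDynamicalSystem H) : Set (QDS.Elem S.M) :=
  ⋂ k : ℤ, QDS.multiplicativeDomain (S.power k)

/-- Complete irreversibility: `D_∞ = ℂ1`. -/
def IsCompletelyIrreversible (S : QuantumDynamicalSystem H) : Prop :=
  S.reversibleAlgebra = Set.range fun c : ℂ => c • (1 : QDS.Elem S.M)

/-- `φ` is of asymptotic equilibrium: `ω(Φ^n(a)) → ω(1) φ(a)` for all `a ∈ M`, `ω ∈ M_*`. -/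
def IsAsymptoticEquilibrium (S : QuantumDynamicalSystem H) : Prop :=
  ∀ a : QDS.Elem S.M, ∀ ω ∈ QDS.predual S.M,
    Tendsto (fun n : ℕ => ω ((S.Φ ^ n) a)) atTop (𝓝 (ω 1 * S.φ a))

/-- Ergodicity: for all `a, b ∈ M`,
`(N + 1)⁻¹ ∑_{k = 0}^{N} [φ(a Φ^k(b)) - φ(a) φ(b)] → 0` as `N → ∞`. -/
def IsErgodic (S : QuantumDynamicalSystem H) : Prop :=
  ∀ a b : QDS.Elem S.M,
    Tendsto (fun N : ℕ => (1 / ((N : ℂ) + 1)) *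
      ∑ k ∈ Finset.range (N + 1), (S.φ (a * (S.Φ ^ k) b) - S.φ a * S.φ b)) atTop (𝓝 0)

end QuantumDynamicalSystem

end

/-! Unital Schwartz maps are norm contractions (`norm_le`), so an orbit `Φ^n(a)` has σ-weak limits
along ultrafilters (`exists_sigmaWeak_limit`), and only their values matter. For the GNS norm `‖a‖²
= φ(a* a)`, `Φ` acts as a contraction `T` with adjoint `Φ♯`, whence `‖T*ᵏTᵏv - v‖² ≤ ‖v‖² - ‖Tᵏv‖²`
(`gnsSq_sub_le`). At `v = Tⁿa` the right side tends to `0`, because `‖Tⁿa‖` decreases. So every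
limit `x` is fixed by `Φ♯ᵏΦᵏ`, and similarly by `ΦᵏΦ♯ᵏ`; faithfulness of `φ` then gives equality in
the Schwarz inequality, and `x ∈ D_∞ = ℂ1`. Invariance of `φ` forces `x = φ(a)1`. -/

namespace QDS

section

variable {H : Type*} [NormedAddCommGroup H] [InnerProductSpace ℂ H] [CompleteSpace H]
  {M : VonNeumannAlgebra H}

/-! ### Positive elements and the σ-weak topology -/

/-- A positive operator in `M` is `y* y` for some `y ∈ M`. -/
theorem exists_eq_star_mul_self {x : Elem M} (hx : 0 ≤ (x : H →L[ℂ] H)) :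
    ∃ y : Elem M, x = star y * y := by
  -- Double commutant: the square root commutes with whatever commutes with `x`.
  have hmem : CFC.sqrt (x : H →L[ℂ] H) ∈ M.toStarSubalgebra := by
    rw [VonNeumannAlgebra.mem_carrier, ← M.centralizer_centralizer, Set.mem_centralizer_iff]
    intro z hz
    have hcomm : Commute (x : H →L[ℂ] H) z := hz _ x.2
    have h := hcomm.cfcₙ_nnreal NNReal.sqrt
    exact h.eq.symm
  refine ⟨⟨_, hmem⟩, Subtype.ext ?_⟩
  have hs : IsSelfAdjoint (CFC.sqrt (x : H →L[ℂ] H)) := (CFC.sqrt_nonneg _).isSelfAdjoint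
  change (x : H →L[ℂ] H) = star (CFC.sqrt (x : H →L[ℂ] H)) * CFC.sqrt (x : H →L[ℂ] H)
  rw [hs.star_eq, CFC.sqrt_mul_sqrt_self _ hx]

theorem coe_star_mul_self_nonneg (y : Elem M) :
    0 ≤ ((star y * y : Elem M) : H →L[ℂ] H) :=
  star_mul_self_nonneg (y : H →L[ℂ] H)

/-- `σ`-weak convergence is convergence of all the functionals `∑ₙ ⟨ξₙ, · ηₙ⟩`. -/
theorem tendsto_nhds_sigmaWeak {ι : Type*} {f : ι → Elem M} {l : Filter ι} {x : Elem M} :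
    Tendsto f l (@nhds (Elem M) (sigmaWeak M) x) ↔
      ∀ ξ η : lp (fun _ : ℕ => H) 2,
        Tendsto (fun i => vectorFunctional M ξ η (f i)) l (𝓝 (vectorFunctional M ξ η x)) := by
  simp only [nhds_iInf, nhds_induced, tendsto_iInf, tendsto_comap_iff, Function.comp_def]

theorem memℓp_apply {E : Type*} [NormedAddCommGroup E] [NormedSpace ℂ E] (T : E →L[ℂ] E)
    (ξ : lp (fun _ : ℕ => E) 2) :
    Memℓp (fun n => T (ξ n)) 2 := by
  have h2 : 0 < (2 : ENNReal).toReal := by norm_num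
  rw [memℓp_gen_iff h2]
  have h := (((memℓp_gen_iff h2).1 (lp.memℓp ξ)).mul_left (‖T‖ ^ (2 : ENNReal).toReal))
  refine h.of_nonneg_of_le (fun n => by positivity) fun n => ?_
  rw [← Real.mul_rpow (norm_nonneg _) (norm_nonneg _)]
  exact Real.rpow_le_rpow (norm_nonneg _) (T.le_opNorm _) h2.le

theorem vectorFunctional_mul (b a : Elem M) (ξ η : lp (fun _ : ℕ => H) 2) :
    vectorFunctional M ξ η (b * a) =
      vectorFunctional M ⟨_, memℓp_apply (star (b : H →L[ℂ] H)) ξ⟩ η a := by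
  refine tsum_congr fun n => ?_
  change inner ℂ (ξ n) ((b : H →L[ℂ] H) ((a : H →L[ℂ] H) (η n))) =
    inner ℂ (star (b : H →L[ℂ] H) (ξ n)) _
  rw [ContinuousLinearMap.star_eq_adjoint, ContinuousLinearMap.adjoint_inner_left]

/-- Left multiplication is `σ`-weakly continuous. -/
theorem tendsto_sigmaWeak_mul_left {ι : Type*} {f : ι → Elem M} {l : Filter ι} {x : Elem M}
    (h : Tendsto f l (@nhds (Elem M) (sigmaWeak M) x)) (b : Elem M) :
    Tendsto (fun i => b * f i) l (@nhds (Elem M) (sigmaWeak M) (b * x)) := by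
  rw [tendsto_nhds_sigmaWeak] at h ⊢
  intro ξ η
  simp only [vectorFunctional_mul]
  exact h _ _

theorem tendsto_of_mem_predual {ω : Elem M →ₗ[ℂ] ℂ} (hω : ω ∈ predual M) {ι : Type*}
    {f : ι → Elem M} {l : Filter ι} {x : Elem M}
    (h : Tendsto f l (@nhds (Elem M) (sigmaWeak M) x)) :
    Tendsto (fun i => ω (f i)) l (𝓝 (ω x)) :=
  ((@Continuous.tendsto _ _ (sigmaWeak M) _ _ hω x).comp h)

theorem tendsto_of_continuous {Φ : Module.End ℂ (Elem M)}
    (hΦ : Continuous[sigmaWeak M, sigmaWeak M] Φ) {ι : Type*}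
    {f : ι → Elem M} {l : Filter ι} {x : Elem M}
    (h : Tendsto f l (@nhds (Elem M) (sigmaWeak M) x)) :
    Tendsto (fun i => Φ (f i)) l (@nhds (Elem M) (sigmaWeak M) (Φ x)) :=
  ((@Continuous.tendsto _ _ (sigmaWeak M) (sigmaWeak M) _ hΦ x).comp h)

/-- On norm-bounded families, weak operator convergence implies `σ`-weak convergence. -/
theorem tendsto_sigmaWeak_of_bounded {ι : Type*} {f : ι → Elem M} {l : Filter ι} {x : Elem M}
    {C : ℝ} (hC : ∀ i, ‖(f i : H →L[ℂ] H)‖ ≤ C)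
    (h : ∀ u v : H, Tendsto (fun i => inner ℂ u ((f i : H →L[ℂ] H) v)) l
      (𝓝 (inner ℂ u ((x : H →L[ℂ] H) v)))) :
    Tendsto f l (@nhds (Elem M) (sigmaWeak M) x) := by
  rw [tendsto_nhds_sigmaWeak]
  intro ξ η
  have h2 : 0 < (2 : ENNReal).toReal := by norm_num
  have hs : ∀ ζ : lp (fun _ : ℕ => H) 2, Summable fun n => ‖ζ n‖ ^ 2 := fun ζ => by
    simpa using (memℓp_gen_iff h2).1 (lp.memℓp ζ)
  have hb : Summable fun n => C * (‖ξ n‖ ^ 2 + ‖η n‖ ^ 2) := ((hs ξ).add (hs η)).mul_left C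
  refine tendsto_tsum_of_dominated_convergence hb (fun n => h _ _) (.of_forall fun i n => ?_)
  have hC0 : 0 ≤ C := (norm_nonneg _).trans (hC i)
  calc ‖inner ℂ (ξ n) ((f i : H →L[ℂ] H) (η n))‖
      ≤ ‖ξ n‖ * ‖(f i : H →L[ℂ] H) (η n)‖ := norm_inner_le_norm _ _
    _ ≤ ‖ξ n‖ * (C * ‖η n‖) := by
        gcongr
        exact (f i : H →L[ℂ] H).le_of_opNorm_le (hC i) _
    _ = C * (‖ξ n‖ * ‖η n‖) := by ring
    _ ≤ C * (‖ξ n‖ ^ 2 + ‖η n‖ ^ 2) := by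
        gcongr
        nlinarith [sq_nonneg (‖ξ n‖ - ‖η n‖), sq_nonneg ‖ξ n‖, sq_nonneg ‖η n‖]

/-- Bounded families of operators have weak operator limits along ultrafilters. -/
theorem exists_weak_limit {ι : Type*} (f : ι → H →L[ℂ] H) {C : ℝ} (hC : ∀ i, ‖f i‖ ≤ C)
    (U : Ultrafilter ι) :
    ∃ T : H →L[ℂ] H, ∀ u v : H, Tendsto (fun i => inner ℂ u (f i v)) U (𝓝 (inner ℂ u (T v))) := by
  have hbd : ∀ u v i, ‖inner ℂ (f i v) u‖ ≤ C * ‖v‖ * ‖u‖ := fun u v i =>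
    (norm_inner_le_norm _ _).trans (by gcongr; exact (f i).le_of_opNorm_le (hC i) _)
  have hex : ∀ v u, ∃ z : ℂ, Tendsto (fun i => inner ℂ (f i v) u) U (𝓝 z) ∧
      ‖z‖ ≤ C * ‖v‖ * ‖u‖ := fun v u => by
    obtain ⟨z, hz, hle⟩ := (isCompact_closedBall (0 : ℂ) (C * ‖v‖ * ‖u‖)).ultrafilter_le_nhds
      (U.map fun i => inner ℂ (f i v) u) (by
        rw [le_principal_iff]
        exact Filter.mem_map.2 (Filter.Eventually.of_forall fun i => by simpa using hbd u v i))
    exact ⟨z, hle, by simpa using hz⟩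
  choose B hB hBle using hex
  -- `B v u = lim ⟨f i v, u⟩` is a bounded sesquilinear form, hence represented by an operator.
  let B' : H →ₗ⋆[ℂ] H →ₗ[ℂ] ℂ := LinearMap.mk₂'ₛₗ (starRingEnd ℂ) (RingHom.id ℂ) B
    (fun v w u => tendsto_nhds_unique (hB _ _)
      (((hB v u).add (hB w u)).congr fun i => by rw [map_add, inner_add_left]))
    (fun c v u => tendsto_nhds_unique (hB _ _)
      (((hB v u).const_mul _).congr fun i => by rw [map_smul, inner_smul_left]))
    (fun v u w => tendsto_nhds_unique (hB _ _)
      (((hB v u).add (hB v w)).congr fun i => by rw [inner_add_right]))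
    (fun c v u => tendsto_nhds_unique (hB _ _)
      (((hB v u).const_mul _).congr fun i => by rw [inner_smul_right]; rfl))
  refine ⟨InnerProductSpace.continuousLinearMapOfBilin (B'.mkContinuous₂ C hBle), fun u v => ?_⟩
  have hT : inner ℂ (InnerProductSpace.continuousLinearMapOfBilin
      (B'.mkContinuous₂ C hBle) v) u = B v u := by
    rw [InnerProductSpace.continuousLinearMapOfBilin_apply]
    rfl
  rw [← inner_conj_symm, hT]
  exact ((Complex.continuous_conj.tendsto _).comp (hB v u)).congr fun i => inner_conj_symm _ _

/-- Norm-bounded families in `M` have `σ`-weak limits in `M` along ultrafilters. -/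
theorem exists_sigmaWeak_limit {ι : Type*} (f : ι → Elem M) {C : ℝ}
    (hC : ∀ i, ‖(f i : H →L[ℂ] H)‖ ≤ C) (U : Ultrafilter ι) :
    ∃ x : Elem M, Tendsto f U (@nhds (Elem M) (sigmaWeak M) x) := by
  obtain ⟨T, hT⟩ := exists_weak_limit (fun i => (f i : H →L[ℂ] H)) hC U
  -- Commutation with the commutant passes to weak limits.
  have hmem : T ∈ M.toStarSubalgebra := by
    rw [VonNeumannAlgebra.mem_carrier, ← M.centralizer_centralizer, Set.mem_centralizer_iff]
    intro z hz
    refine ContinuousLinearMap.ext fun v => ext_inner_left ℂ fun u => ?_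
    have h1 := hT u (z v)
    have h2 := hT (ContinuousLinearMap.adjoint z u) v
    simp only [ContinuousLinearMap.adjoint_inner_left] at h2
    refine tendsto_nhds_unique h2 (h1.congr fun i => ?_)
    have := hz _ (f i).2
    exact congrArg (inner ℂ u) (DFunLike.congr_fun this v)
  exact ⟨⟨T, hmem⟩, tendsto_sigmaWeak_of_bounded hC hT⟩

/-! ### Unital Schwartz maps -/

namespace IsUnitalSchwartzMap

variable {Φ Ψ : Module.End ℂ (Elem M)}

theorem nonneg_of_nonneg (h : IsUnitalSchwartzMap Φ) {a : Elem M}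
    (ha : 0 ≤ (a : H →L[ℂ] H)) : 0 ≤ (Φ a : H →L[ℂ] H) := by
  obtain ⟨y, rfl⟩ := exists_eq_star_mul_self ha
  exact (h.nonneg y).trans (h.schwarz y)

theorem mono (h : IsUnitalSchwartzMap Φ) {a b : Elem M}
    (hab : (a : H →L[ℂ] H) ≤ (b : H →L[ℂ] H)) : (Φ a : H →L[ℂ] H) ≤ (Φ b : H →L[ℂ] H) := by
  have := h.nonneg_of_nonneg (a := b - a) (by simpa using hab)
  simpa using this

theorem isSelfAdjoint_star_mul (h : IsUnitalSchwartzMap Φ) (a : Elem M) :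
    star (Φ (star a) * Φ a) = Φ (star a) * Φ a :=
  Subtype.ext (IsSelfAdjoint.of_nonneg (h.nonneg a)).star_eq

/-- Positivity makes `Φ(b*)Φ(b)` self-adjoint. Replacing `b` by `b + 1` shows that `Φ(b*) + Φ(b)` is
self-adjoint too; the cases `b = a` and `b = i a` together give the claim. -/
theorem map_star (h : IsUnitalSchwartzMap Φ) (a : Elem M) : Φ (star a) = star (Φ a) := by
  have key : ∀ b : Elem M, star (Φ (star b) + Φ b) = Φ (star b) + Φ b := fun b => by
    have h0 := h.isSelfAdjoint_star_mul b
    have h1 := h.isSelfAdjoint_star_mul (b + 1)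
    have e : Φ (star (b + 1)) * Φ (b + 1) = Φ (star b) * Φ b + (Φ (star b) + Φ b) + 1 := by
      rw [star_add, star_one, map_add, map_add, h.map_one]
      noncomm_ring
    rw [e, star_add, star_one, star_add, h0] at h1
    exact add_left_cancel (add_right_cancel h1)
  have h1 := key a
  have h2 := key (Complex.I • a)
  simp only [star_smul, map_smul, star_add, Complex.star_def, Complex.conj_I, map_neg, neg_neg,
    neg_smul, star_neg] at h1 h2
  have h3 : star (Φ (star a)) - star (Φ a) = Φ a - Φ (star a) := by
    refine smul_right_injective (Elem M) Complex.I_ne_zero ?_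
    change Complex.I • (star (Φ (star a)) - star (Φ a)) = Complex.I • (Φ a - Φ (star a))
    have h2' : Complex.I • star (Φ (star a)) + -(Complex.I • star (Φ a)) =
        -(Complex.I • Φ (star a)) + Complex.I • Φ a := h2
    rw [smul_sub, smul_sub, sub_eq_add_neg, h2']
    abel
  have h4 : (2 : ℂ) • Φ (star a) = (2 : ℂ) • star (Φ a) := by
    have : star (Φ (star a)) = Φ a - Φ (star a) + star (Φ a) := sub_eq_iff_eq_add.1 h3
    rw [this] at h1
    rw [two_smul, two_smul]
    have h5 := congrArg (fun t => t - Φ a + Φ (star a)) h1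
    calc _ = Φ (star a) + Φ a - Φ a + Φ (star a) := by abel
      _ = _ := by rw [← h5]; abel
  exact smul_right_injective (Elem M) two_ne_zero h4

/-- `Φ(a)*Φ(a) ≤ Φ(a* a) ≤ ‖a‖²1`, and the C*-identity applies. -/
theorem norm_le (h : IsUnitalSchwartzMap Φ) (a : Elem M) :
    ‖(Φ a : H →L[ℂ] H)‖ ≤ ‖(a : H →L[ℂ] H)‖ := by
  have h1 : ((Φ (star a * a) : Elem M) : H →L[ℂ] H) ≤
      algebraMap ℝ (H →L[ℂ] H) (‖(a : H →L[ℂ] H)‖ ^ 2) := by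
    have hle : ((star a * a : Elem M) : H →L[ℂ] H) ≤
        ((((‖(a : H →L[ℂ] H)‖ ^ 2 : ℝ) : ℂ) • (1 : Elem M) : Elem M) : H →L[ℂ] H) := by
      have := CStarAlgebra.star_mul_le_algebraMap_norm_sq (a := (a : H →L[ℂ] H))
      rw [Algebra.algebraMap_eq_smul_one, ← Complex.coe_smul] at this
      exact this
    have := h.mono hle
    rw [map_smul, h.map_one] at this
    rw [Algebra.algebraMap_eq_smul_one, ← Complex.coe_smul]
    exact this
  have h2 := (h.schwarz a).trans h1
  rw [← CStarAlgebra.norm_le_iff_le_algebraMap _ (by positivity) (h.nonneg a), h.map_star] at h2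
  have h3 : ‖(Φ a : H →L[ℂ] H)‖ * ‖(Φ a : H →L[ℂ] H)‖ ≤ ‖(a : H →L[ℂ] H)‖ ^ 2 := by
    rw [← CStarRing.norm_star_mul_self]
    exact h2
  exact abs_le_of_sq_le_sq' (by rwa [sq (‖(Φ a : H →L[ℂ] H)‖)]) (norm_nonneg _) |>.2

protected theorem one : IsUnitalSchwartzMap (1 : Module.End ℂ (Elem M)) where
  normal := @continuous_id _ (sigmaWeak M)
  map_one := rfl
  nonneg := coe_star_mul_self_nonneg
  schwarz _ := le_rfl

protected theorem mul (h : IsUnitalSchwartzMap Φ) (h' : IsUnitalSchwartzMap Ψ) :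
    IsUnitalSchwartzMap (Φ * Ψ) where
  normal := @Continuous.comp _ _ _ (sigmaWeak M) (sigmaWeak M) (sigmaWeak M) Ψ Φ h.normal h'.normal
  map_one := by simp [h.map_one, h'.map_one]
  nonneg a := by
    simpa [h'.map_star] using h.nonneg (Ψ a)
  schwarz a := by
    have h1 := h.schwarz (Ψ a)
    rw [← h'.map_star] at h1
    exact h1.trans (h.mono (h'.schwarz a))

protected theorem pow (h : IsUnitalSchwartzMap Φ) : ∀ n : ℕ, IsUnitalSchwartzMap (Φ ^ n)
  | 0 => .one
  | n + 1 => by rw [pow_succ]; exact (h.pow n).mul h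

end IsUnitalSchwartzMap

/-! ### The GNS norm of the state -/

/-- The squared GNS norm `φ(a* a)`. -/
noncomputable def gnsSq (φ : Elem M →ₗ[ℂ] ℂ) (a : Elem M) : ℝ := (φ (star a * a)).re

namespace IsFaithfulNormalState

variable {φ : Elem M →ₗ[ℂ] ℂ}

theorem nonneg_of_nonneg (h : IsFaithfulNormalState φ) {a : Elem M}
    (ha : 0 ≤ (a : H →L[ℂ] H)) : 0 ≤ φ a := by
  obtain ⟨y, rfl⟩ := exists_eq_star_mul_self ha
  exact h.nonneg y

theorem eq_zero_of_nonneg (h : IsFaithfulNormalState φ) {a : Elem M}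
    (ha : 0 ≤ (a : H →L[ℂ] H)) (h0 : φ a = 0) : a = 0 := by
  obtain ⟨y, rfl⟩ := exists_eq_star_mul_self ha
  rw [h.faithful y h0, mul_zero]

theorem map_star (h : IsFaithfulNormalState φ) (a : Elem M) : φ (star a) = star (φ a) := by
  have key : ∀ b : Elem M, (φ (star b)).im + (φ b).im = 0 := fun b => by
    have h0 := (Complex.nonneg_iff.1 (h.nonneg b)).2
    have h1 := (Complex.nonneg_iff.1 (h.nonneg (b + 1))).2
    simp only [star_add, star_one, add_mul, mul_add, one_mul, mul_one, map_add, h.map_one,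
      Complex.add_im, Complex.one_im, ← h0] at h1
    linarith
  have h1 := key a
  have h2 := key (Complex.I • a)
  simp at h2
  apply Complex.ext
  · simp; linarith
  · simp; linarith

theorem gnsSq_nonneg (h : IsFaithfulNormalState φ) (a : Elem M) : 0 ≤ gnsSq φ a :=
  (Complex.nonneg_iff.1 (h.nonneg a)).1

/-- The Cauchy–Schwarz inequality for `(a, b) ↦ φ(a* b)`. -/
theorem norm_sq_le (h : IsFaithfulNormalState φ) (a b : Elem M) :
    ‖φ (star a * b)‖ ^ 2 ≤ gnsSq φ a * gnsSq φ b := by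
  let c : PreInnerProductSpace.Core ℂ (Elem M) :=
    { inner := fun a b => φ (star a * b)
      conj_inner_symm := fun a b => by
        change star (φ (star b * a)) = φ (star a * b)
        rw [← h.map_star, star_mul, star_star]
      re_inner_nonneg := h.gnsSq_nonneg
      add_left := fun a b d => by rw [star_add, add_mul, map_add]
      smul_left := fun a b r => by
        rw [star_smul, smul_mul_assoc, map_smul]; rfl }
  have h1 := @InnerProductSpace.Core.inner_mul_inner_self_le ℂ (Elem M) _ _ _ c a b
  have h2 : ‖φ (star b * a)‖ = ‖φ (star a * b)‖ := by
    rw [← norm_star (φ (star b * a)), ← h.map_star, star_mul, star_star]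
  change ‖φ (star a * b)‖ * ‖φ (star b * a)‖ ≤ gnsSq φ a * gnsSq φ b at h1
  rwa [h2, ← sq] at h1

end IsFaithfulNormalState

/-! ### The dynamics as a GNS contraction, and its adjoint -/

namespace IsAdjoint

variable {φ : Elem M →ₗ[ℂ] ℂ} {Φ Ψ : Module.End ℂ (Elem M)}

theorem map_apply (h : IsAdjoint φ Φ Ψ) (a : Elem M) : φ (Φ a) = φ a := by
  simpa [h.schwartz.map_one] using h.adjoint a 1

protected theorem symm (hφ : IsFaithfulNormalState φ) (hΦ : IsUnitalSchwartzMap Φ)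
    (h : IsAdjoint φ Φ Ψ) : IsAdjoint φ Ψ Φ where
  schwartz := hΦ
  adjoint a b := by
    have := congrArg star (h.adjoint (star b) (star a))
    rw [← hφ.map_star, ← hφ.map_star, star_mul, star_mul, hΦ.map_star, h.schwartz.map_star] at this
    simpa using this.symm

protected theorem pow (h : IsAdjoint φ Φ Ψ) (n : ℕ) : IsAdjoint φ (Φ ^ n) (Ψ ^ n) where
  schwartz := h.schwartz.pow n
  adjoint := by
    induction n with
    | zero => simp
    | succ n ih =>
      intro a b
      rw [pow_succ, pow_succ', Module.End.mul_apply, Module.End.mul_apply, ih, h.adjoint]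

/-- Schwartz maps preserving the state contract the GNS norm. -/
theorem gnsSq_map_le (hφ : IsFaithfulNormalState φ) (hΦ : IsUnitalSchwartzMap Φ)
    (h : IsAdjoint φ Φ Ψ) (a : Elem M) : gnsSq φ (Φ a) ≤ gnsSq φ a := by
  have h1 : 0 ≤ φ (Φ (star a * a) - Φ (star a) * Φ a) :=
    hφ.nonneg_of_nonneg (by simpa using hΦ.schwarz a)
  have h2 := (Complex.nonneg_iff.1 h1).1
  rw [map_sub, h.map_apply, hΦ.map_star, Complex.sub_re] at h2
  exact sub_nonneg.1 h2

/-- Expand `‖T*Tv - v‖² = ‖T*Tv‖² - 2‖Tv‖² + ‖v‖²` and use `‖T*Tv‖ ≤ ‖Tv‖`. -/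
theorem gnsSq_sub_le (hφ : IsFaithfulNormalState φ) (hΦ : IsUnitalSchwartzMap Φ)
    (h : IsAdjoint φ Φ Ψ) (a : Elem M) :
    gnsSq φ (Ψ (Φ a) - a) ≤ gnsSq φ a - gnsSq φ (Φ a) := by
  have h1 : φ (star (Ψ (Φ a)) * a) = φ (star (Φ a) * Φ a) := by
    rw [← h.schwartz.map_star, ← h.adjoint]
  have h2 : φ (star a * Ψ (Φ a)) = φ (star (Φ a) * Φ a) := by
    rw [(h.symm hφ hΦ).adjoint, hΦ.map_star]
  have h3 := (h.symm hφ hΦ).gnsSq_map_le hφ h.schwartz (Φ a)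
  have h4 : gnsSq φ (Ψ (Φ a) - a) =
      gnsSq φ (Ψ (Φ a)) - gnsSq φ (Φ a) - gnsSq φ (Φ a) + gnsSq φ a := by
    unfold gnsSq
    rw [star_sub, sub_mul, mul_sub, mul_sub, map_sub, map_sub, map_sub, h1, h2]
    simp only [Complex.sub_re]
    ring
  linarith

/-- An element fixed by `Φ♯ Φ` satisfies equality in the Schwarz inequality for `Φ`. -/
theorem map_star_mul_self (hφ : IsFaithfulNormalState φ) (hΦ : IsUnitalSchwartzMap Φ)
    (h : IsAdjoint φ Φ Ψ) {x : Elem M} (hx : Ψ (Φ x) = x) :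
    Φ (star x * x) = Φ (star x) * Φ x := by
  rw [← sub_eq_zero]
  -- The Schwarz defect is positive, so it suffices that `φ` kills it: both of its terms have
  -- `φ`-value `φ(x* x)`.
  refine hφ.eq_zero_of_nonneg (by simpa using hΦ.schwarz x) ?_
  rw [map_sub, h.map_apply, h.adjoint, hΦ.map_star, h.schwartz.map_star, hx, sub_self]

theorem mem_multiplicativeDomain (hφ : IsFaithfulNormalState φ) (hΦ : IsUnitalSchwartzMap Φ)
    (h : IsAdjoint φ Φ Ψ) {x : Elem M} (hx : Ψ (Φ x) = x) : x ∈ multiplicativeDomain Φ := by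
  refine ⟨h.map_star_mul_self hφ hΦ hx, ?_⟩
  have := h.map_star_mul_self hφ hΦ (x := star x)
    (by rw [hΦ.map_star, h.schwartz.map_star, hx])
  simpa using this

theorem tendsto_gnsSq (hφ : IsFaithfulNormalState φ) (hΦ : IsUnitalSchwartzMap Φ)
    (h : IsAdjoint φ Φ Ψ) (a : Elem M) (k : ℕ) :
    Tendsto (fun n => gnsSq φ ((Ψ ^ k) ((Φ ^ k) ((Φ ^ n) a)) - (Φ ^ n) a)) atTop (𝓝 0) := by
  have hanti : Antitone fun n => gnsSq φ ((Φ ^ n) a) := antitone_nat_of_succ_le fun n => by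
    rw [pow_succ', Module.End.mul_apply]
    exact h.gnsSq_map_le hφ hΦ _
  have hlim := tendsto_atTop_ciInf hanti ⟨0, by rintro _ ⟨n, rfl⟩; exact hφ.gnsSq_nonneg _⟩
  -- The bound is the drop of a convergent sequence between times `n` and `n + k`.
  have hdiff := hlim.sub ((tendsto_add_atTop_iff_nat k).2 hlim)
  rw [sub_self] at hdiff
  refine squeeze_zero (fun n => hφ.gnsSq_nonneg _) (fun n => ?_) hdiff
  have := (h.pow k).gnsSq_sub_le hφ (hΦ.pow k) ((Φ ^ n) a)
  rwa [← Module.End.mul_apply (Φ ^ k), ← pow_add, add_comm k n] at this ⊢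

theorem tendsto_gnsSq' (hφ : IsFaithfulNormalState φ) (hΦ : IsUnitalSchwartzMap Φ)
    (h : IsAdjoint φ Φ Ψ) (a : Elem M) (k : ℕ) :
    Tendsto (fun n => gnsSq φ ((Φ ^ k) ((Ψ ^ k) ((Φ ^ n) a)) - (Φ ^ n) a)) atTop (𝓝 0) := by
  -- At time `n + k` the difference is `Φᵏ` of the one in `tendsto_gnsSq`, and `Φᵏ` is a GNS
  -- contraction.
  rw [← tendsto_add_atTop_iff_nat k]
  refine squeeze_zero (fun n => hφ.gnsSq_nonneg _) (fun n => ?_) (h.tendsto_gnsSq hφ hΦ a k)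
  have := (h.pow k).gnsSq_map_le hφ (hΦ.pow k) ((Ψ ^ k) ((Φ ^ k) ((Φ ^ n) a)) - (Φ ^ n) a)
  rw [map_sub] at this
  rwa [← Module.End.mul_apply (Φ ^ k) (Φ ^ n), ← pow_add, add_comm k n] at this ⊢

end IsAdjoint

/-- A `σ`-weak limit of elements that are asymptotically fixed by a `σ`-weakly continuous map in
the GNS norm is fixed by that map. -/
theorem apply_eq_of_tendsto {φ : Elem M →ₗ[ℂ] ℂ} (hφ : IsFaithfulNormalState φ)
    {P : Module.End ℂ (Elem M)} (hP : Continuous[sigmaWeak M, sigmaWeak M] P)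
    {ι : Type*} {f : ι → Elem M} {l : Filter ι} [l.NeBot] {x : Elem M}
    (hf : Tendsto f l (@nhds (Elem M) (sigmaWeak M) x))
    (h : Tendsto (fun i => gnsSq φ (P (f i) - f i)) l (𝓝 0)) : P x = x := by
  rw [← sub_eq_zero]
  refine hφ.faithful _ ?_
  set b := P x - x with hb
  -- The same scalars tend to `φ(b* b)` by σ-weak continuity and to `0` by Cauchy–Schwarz.
  have h1 : Tendsto (fun i => φ (star b * (P (f i) - f i))) l (𝓝 (φ (star b * b))) := by
    have hPf := tendsto_of_mem_predual hφ.normal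
      (tendsto_sigmaWeak_mul_left (tendsto_of_continuous hP hf) (star b))
    have hff := tendsto_of_mem_predual hφ.normal (tendsto_sigmaWeak_mul_left hf (star b))
    simpa only [mul_sub, map_sub, hb] using hPf.sub hff
  have h2 : Tendsto (fun i => ‖φ (star b * (P (f i) - f i))‖ ^ 2) l (𝓝 0) :=
    squeeze_zero (fun i => by positivity) (fun i => hφ.norm_sq_le _ _)
      (by simpa using h.const_mul (gnsSq φ b))
  have h3 := tendsto_nhds_unique (h1.norm.pow 2) h2
  simpa using h3

end

end QDS

/-! ### Limit points of orbits and the conclusion -/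

namespace QuantumDynamicalSystem

variable {H : Type*} [NormedAddCommGroup H] [InnerProductSpace ℂ H] [CompleteSpace H]

/-- The `σ`-weak limit points of an orbit lie in the reversible algebra. -/
theorem mem_reversibleAlgebra_of_tendsto (S : QuantumDynamicalSystem H) {a x : QDS.Elem S.M}
    {l : Filter ℕ} [l.NeBot] (hl : l ≤ atTop)
    (hx : Tendsto (fun n => (S.Φ ^ n) a) l (@nhds (QDS.Elem S.M) (QDS.sigmaWeak S.M) x)) :
    x ∈ S.reversibleAlgebra := by
  have hΦ := S.schwartz
  have hΨ := S.isAdjoint_sharp.schwartz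
  have h := S.isAdjoint_sharp
  refine Set.mem_iInter.2 fun k => ?_
  set m := k.natAbs
  have h1 : (S.sharp ^ m) ((S.Φ ^ m) x) = x :=
    QDS.apply_eq_of_tendsto S.state ((hΨ.pow m).mul (hΦ.pow m)).normal hx
      ((h.tendsto_gnsSq S.state hΦ a m).mono_left hl)
  have h2 : (S.Φ ^ m) ((S.sharp ^ m) x) = x :=
    QDS.apply_eq_of_tendsto S.state ((hΦ.pow m).mul (hΨ.pow m)).normal hx
      ((h.tendsto_gnsSq' S.state hΦ a m).mono_left hl)
  unfold power
  split_ifs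
  · exact (h.pow m).mem_multiplicativeDomain S.state (hΦ.pow m) h1
  · exact ((h.symm S.state hΦ).pow m).mem_multiplicativeDomain S.state (hΨ.pow m) h2

theorem map_pow (S : QuantumDynamicalSystem H) (n : ℕ) (a : QDS.Elem S.M) :
    S.φ ((S.Φ ^ n) a) = S.φ a :=
  (S.isAdjoint_sharp.pow n).map_apply a

theorem tendsto_sigmaWeak (S : QuantumDynamicalSystem H) (hS : S.IsCompletelyIrreversible)
    (a : QDS.Elem S.M) : Tendsto (fun n : ℕ => (S.Φ ^ n) a) atTop
      (@nhds (QDS.Elem S.M) (QDS.sigmaWeak S.M) (S.φ a • (1 : QDS.Elem S.M))) := by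
  rw [tendsto_iff_ultrafilter]
  intro U hU
  obtain ⟨x, hx⟩ := QDS.exists_sigmaWeak_limit (fun n => (S.Φ ^ n) a)
    (fun n => (S.schwartz.pow n).norm_le a) U
  have hmem := S.mem_reversibleAlgebra_of_tendsto hU hx
  rw [hS] at hmem
  obtain ⟨c, rfl⟩ := hmem
  -- Normality and invariance of `φ` identify `c` as `φ(a)`.
  have h1 := QDS.tendsto_of_mem_predual S.state.normal hx
  simp only [S.map_pow, map_smul, S.state.map_one, smul_eq_mul, mul_one] at h1
  rwa [tendsto_nhds_unique tendsto_const_nhds h1]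

end QuantumDynamicalSystem

theorem mainTheorem6 {H : Type*} [NormedAddCommGroup H] [InnerProductSpace ℂ H] [CompleteSpace H]
    (S : QuantumDynamicalSystem H) (hS : S.IsCompletelyIrreversible) :
    (∀ a : QDS.Elem S.M, Tendsto (fun n : ℕ => (S.Φ ^ n) a) atTop
      (@nhds (QDS.Elem S.M) (QDS.sigmaWeak S.M) (S.φ a • (1 : QDS.Elem S.M)))) ∧
    S.IsAsymptoticEquilibrium ∧ S.IsErgodic := by
  refine ⟨S.tendsto_sigmaWeak hS, fun a ω hω => ?_, fun a b => ?_⟩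
  · have := QDS.tendsto_of_mem_predual hω (S.tendsto_sigmaWeak hS a)
    rwa [map_smul, smul_eq_mul, mul_comm] at this
  · have h1 := QDS.tendsto_of_mem_predual S.state.normal
      (QDS.tendsto_sigmaWeak_mul_left (S.tendsto_sigmaWeak hS b) a)
    rw [mul_smul_comm, mul_one, map_smul, smul_eq_mul, mul_comm] at h1
    have h2 := (h1.sub_const (S.φ a * S.φ b)).cesaro_smul
    rw [sub_self] at h2
    -- `cesaro_smul` averages `N` terms; the shift by one gives the `N + 1` terms required.
    refine ((tendsto_add_atTop_iff_nat 1).2 h2).congr fun N => ?_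
    rw [← Complex.coe_smul, smul_eq_mul]
    push_cast
    rw [one_div]
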